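/- **Definitions (algebras).** A *distributive $\nabla$-algebra* is a tuple $\mathcal A=(\mathsf A,\nabla,\to)$ where $\mathsf A$ is a bounded distributive lattice and $\nabla c\wedge a\le b \iff c\le a\to b$ for all $a,b,c\in A$; put $\Box a=1\to a$. It may satisfy: $(N)$ $\nabla 1=1$ and $\nabla(a\wedge b)=\nabla a\wedge\nabla b$; $(H)$ $\mathsf A$ is a Heyting algebra (a Heyting implication exists); $(R)$ $a\le\nabla a$; $(L)$ $\nabla a\le a$; $(Fa)$ $\nabla$ is surjective; $(Fu)$ $\Box$ is surjective. Morphisms are bounded lattice morphisms preserving $\nabla$ and $\to$. For $C\subseteq\{N,H,R,L,Fa,Fu\}$, $\mathbf{Alg}_\nabla(D,C)$ is the category of distributive $\nabla$-algebras satisfying all conditions in $C$. An *explicitly Heyting $\nabla$-algebra* is a $\nabla$-algebra on a Heyting algebra with the Heyting implication $\supset$ in the signature; with the morphisms that also preserve $\supset$, those satisfying $C$ form $\mathbf{Alg}^H_\nabla(D,C)$. **Definitions (spaces).** A *Priestley space* is a compact topological space $X$ with a partial order such that whenever $x\nleq y$ some clopen upset contains $x$ but not $y$; it is *Esakia* if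 ${\downarrow}U$ is clopen for every clopen $U$. A *$\nabla$-space* is a Priestley space $(X,\le)$ with a relation $R\subseteq X^2$ such that: $x'\le x$, $(x,y)\in R$, $y\le y'$ imply $(x',y')\in R$; $R[x]=\{y\mid (x,y)\in R\}$ is closed for every $x$; $\{x\mid \exists y\in U\,(x,y)\in R\}$ is clopen for every clopen $U$; and $\nabla_R(V)=\{x\mid\exists y\in V\,(y,x)\in R\}$ is a clopen upset for every clopen upset $V$. It may satisfy: $(N)$ there is an order-preserving $\pi:X\to X$ with $(x,y)\in R\iff x\le\pi(y)$; $(H)$ $(X,\le)$ is Esakia; $(R)$ $R$ is reflexive; $(L)$ $R\subseteq{\le}$; $(Fa)$ for every $x$ there is $y$ with $(y,x)\in R$ such that $(y,z)\in R$ implies $x\le z$; $(Fu)$ for every $x$ there is $y$ with $(x,y)\in R$ such that $(z,y)\in R$ implies $z\le x$. A *$\nabla$-space map* $f:X\to Y$ is a continuous order-preserving map such that $(k,l)\in R_X$ implies $(f(k),f(l))\in R_Y$; $(f(k),l')\in R_Y$ implies that there is $l$ with $(k,l)\in R_X$ and $f(l)=l'$; and $(l',f(k))\in R_Y$ implies that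 there is $l$ with $(l,k)\in R_X$ and $f(l)\ge l'$. It is *Heyting* if moreover $f(k)\le l'$ implies that there is $l\ge k$ with $f(l)=l'$. $\mathbf{Space}_\nabla(C)$ is the category of $\nabla$-spaces satisfying $C$ with $\nabla$-space maps, and $\mathbf{Space}^H_\nabla(C)$ is that of $\nabla$-spaces over Esakia spaces satisfying $C$ with Heyting $\nabla$-space maps. **Functors.** $\mathfrak S(\mathcal A)=(\mathcal F_p(\mathsf A),\subseteq,R)$ is the set of prime (in particular proper) filters of $\mathsf A$, with the topology with basis $\{P\mid a\in P,\ b\notin P\}$ ($a,b\in A$), and $(P,Q)\in R\iff\nabla[P]\subseteq Q$; $\mathfrak S(f)=f^{-1}$. $\mathfrak A(X,\le,R)=(CU(X,\le),\nabla_R,\to_R)$ is the lattice of clopen upsets with $\nabla_R$ as above and $U\to_R V=\{x\mid R[x]\cap U\subseteq V\}$ (in the explicitly Heyting case together with the Heyting implication of $CU(X,\le)$); $\mathfrak A(f)=f^{-1}$. **Theorem.** Let $C\subseteq\{N,H,R,L,Fa,Fu\}$. Then $\mathfrak S:\mathbf{Alg}_\nabla(D,C)\to\mathbf{Space}_\nabla(C)^{op}$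 and $\mathfrak A:\mathbf{Space}_\nabla(C)^{op}\to\mathbf{Alg}_\nabla(D,C)$ are functors and, together with the natural isomorphisms $$\alpha:\mathcal A\to\mathfrak A\mathfrak S(\mathcal A),\quad \alpha(a)=\{P\in\mathcal F_p(\mathsf A)\mid a\in P\},$$ $$\beta:(X,\le,R)\to\mathfrak S\mathfrak A(X,\le,R),\quad \beta(x)=\{U\in CU(X,\le)\mid x\in U\},$$ they form an (adjoint) equivalence between $\mathbf{Alg}_\nabla(D,C)$ and $\mathbf{Space}_\nabla(C)^{op}$, with unit $\alpha$ and counit $\beta$ (read in the opposite category). The same $\mathfrak S$, $\mathfrak A$, $\alpha$, $\beta$ give an (adjoint) equivalence between $\mathbf{Alg}^H_\nabla(D,C)$ and $\mathbf{Space}^H_\nabla(C)^{op}$. -/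

import Mathlib

open CategoryTheory Opposite

universe u

namespace NablaDuality

/-! ### Algebras -/

/-- The labels of the conditions: normal, Heyting, right, left, faithful, full. -/
inductive NablaCond where
  | N
  | H
  | R
  | L
  | Fa
  | Fu

/-- A `∇`-algebra: a bounded lattice with operations `∇` and `→` such that
`∇ c ⊓ a ≤ b ↔ c ≤ a → b`. -/
class NablaAlgebra (A : Type u) [Lattice A] [BoundedOrder A] where
  nabla : A → A
  imp : A → A → A
  nabla_inf_le_iff : ∀ a b c : A, nabla c ⊓ a ≤ b ↔ c ≤ imp a b

open NablaAlgebra (nabla imp nabla_inf_le_iff)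

/-- `□ a = (1 → a)`. -/
def box {A : Type u} [Lattice A] [BoundedOrder A] [NablaAlgebra A] (a : A) : A := imp ⊤ a

/-- The meaning of each condition on a `∇`-algebra. The Heyting condition only asks that
the Heyting implication exists. -/
def NablaAlgebra.Satisfies (A : Type u) [Lattice A] [BoundedOrder A] [NablaAlgebra A] :
    NablaCond → Prop
  | .N => nabla (⊤ : A) = ⊤ ∧ ∀ a b : A, nabla (a ⊓ b) = nabla a ⊓ nabla b
  | .H => ∀ a b : A, ∃ h : A, ∀ x : A, x ≤ h ↔ x ⊓ a ≤ b
  | .R => ∀ a : A, a ≤ nabla a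
  | .L => ∀ a : A, nabla a ≤ a
  | .Fa => Function.Surjective (nabla : A → A)
  | .Fu => Function.Surjective (box : A → A)

/-- A `∇`-algebra morphism: a bounded lattice morphism preserving `∇` and `→`. -/
structure NablaHom (A B : Type u) [Lattice A] [BoundedOrder A] [NablaAlgebra A]
    [Lattice B] [BoundedOrder B] [NablaAlgebra B] extends BoundedLatticeHom A B where
  map_nabla' : ∀ a, toFun (nabla a) = nabla (toFun a)
  map_imp' : ∀ a b, toFun (imp a b) = imp (toFun a) (toFun b)

namespace NablaHom

variable {A B D : Type u} [Lattice A] [BoundedOrder A] [NablaAlgebra A]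
  [Lattice B] [BoundedOrder B] [NablaAlgebra B] [Lattice D] [BoundedOrder D] [NablaAlgebra D]

instance : FunLike (NablaHom A B) A B where
  coe f := f.toFun
  coe_injective f g h := by
    obtain ⟨f, _, _⟩ := f
    obtain ⟨g, _, _⟩ := g
    congr
    exact DFunLike.coe_injective h

@[ext] theorem ext {f g : NablaHom A B} (h : ∀ a, f a = g a) : f = g := DFunLike.ext _ _ h

theorem map_nabla (f : NablaHom A B) (a : A) : f (nabla a) = nabla (f a) := f.map_nabla' a
theorem map_imp (f : NablaHom A B) (a b : A) : f (imp a b) = imp (f a) (f b) := f.map_imp' a b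
theorem map_inf (f : NablaHom A B) (a b : A) : f (a ⊓ b) = f a ⊓ f b := f.map_inf' a b
theorem map_sup (f : NablaHom A B) (a b : A) : f (a ⊔ b) = f a ⊔ f b := f.map_sup' a b
theorem map_top (f : NablaHom A B) : f ⊤ = ⊤ := f.map_top'
theorem map_bot (f : NablaHom A B) : f ⊥ = ⊥ := f.map_bot'

/-- The identity morphism. -/
def id (A : Type u) [Lattice A] [BoundedOrder A] [NablaAlgebra A] : NablaHom A A where
  toBoundedLatticeHom := BoundedLatticeHom.id A
  map_nabla' _ := rfl
  map_imp' _ _ := rfl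

/-- Composition of morphisms. -/
def comp (g : NablaHom B D) (f : NablaHom A B) : NablaHom A D where
  toBoundedLatticeHom := g.toBoundedLatticeHom.comp f.toBoundedLatticeHom
  map_nabla' a := (congrArg g (f.map_nabla a)).trans (g.map_nabla _)
  map_imp' a b := (congrArg g (f.map_imp a b)).trans (g.map_imp _ _)

end NablaHom

/-- A Heyting `∇`-algebra morphism: it also preserves the Heyting implication. -/
structure HeytingNablaHom (A B : Type u) [HeytingAlgebra A] [NablaAlgebra A]
    [HeytingAlgebra B] [NablaAlgebra B] extends NablaHom A B where
  map_himp' : ∀ a b : A, toFun (a ⇨ b) = toFun a ⇨ toFun b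

namespace HeytingNablaHom

variable {A B D : Type u} [HeytingAlgebra A] [NablaAlgebra A]
  [HeytingAlgebra B] [NablaAlgebra B] [HeytingAlgebra D] [NablaAlgebra D]

instance : FunLike (HeytingNablaHom A B) A B where
  coe f := f.toFun
  coe_injective f g h := by
    obtain ⟨f, _⟩ := f
    obtain ⟨g, _⟩ := g
    congr
    exact DFunLike.coe_injective h

@[ext] theorem ext {f g : HeytingNablaHom A B} (h : ∀ a, f a = g a) : f = g := DFunLike.ext _ _ h

theorem map_himp (f : HeytingNablaHom A B) (a b : A) : f (a ⇨ b) = f a ⇨ f b := f.map_himp' a b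

/-- The identity morphism. -/
def id (A : Type u) [HeytingAlgebra A] [NablaAlgebra A] : HeytingNablaHom A A where
  toNablaHom := NablaHom.id A
  map_himp' _ _ := rfl

/-- Composition of morphisms. -/
def comp (g : HeytingNablaHom B D) (f : HeytingNablaHom A B) : HeytingNablaHom A D where
  toNablaHom := g.toNablaHom.comp f.toNablaHom
  map_himp' a b := (congrArg g (f.map_himp a b)).trans (g.map_himp _ _)

end HeytingNablaHom

/-- The objects of `Alg_∇(D, C)`: distributive `∇`-algebras satisfying the conditions in `C`. -/
structure DNablaAlg (C : Set NablaCond) where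
  carrier : Type u
  [distribLattice : DistribLattice carrier]
  [boundedOrder : BoundedOrder carrier]
  [nablaAlgebra : NablaAlgebra carrier]
  satisfies : ∀ c ∈ C, NablaAlgebra.Satisfies carrier c

namespace DNablaAlg

variable {C : Set NablaCond}

instance : CoeSort (DNablaAlg.{u} C) (Type u) := ⟨carrier⟩

attribute [instance] distribLattice boundedOrder nablaAlgebra

/-- Morphisms of `Alg_∇(D, C)`: all `∇`-algebra morphisms. -/
@[ext] structure Hom (A B : DNablaAlg.{u} C) where
  hom : NablaHom A B

instance : Category (DNablaAlg.{u} C) where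
  Hom := Hom
  id A := ⟨NablaHom.id A⟩
  comp f g := ⟨g.hom.comp f.hom⟩

end DNablaAlg

/-- The objects of `Alg_∇^H(D, C)`: explicitly Heyting `∇`-algebras satisfying the conditions
in `C`. They are automatically distributive. -/
structure HNablaAlg (C : Set NablaCond) where
  carrier : Type u
  [heytingAlgebra : HeytingAlgebra carrier]
  [nablaAlgebra : NablaAlgebra carrier]
  satisfies : ∀ c ∈ C, NablaAlgebra.Satisfies carrier c

namespace HNablaAlg

variable {C : Set NablaCond}

instance : CoeSort (HNablaAlg.{u} C) (Type u) := ⟨carrier⟩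

attribute [instance] heytingAlgebra nablaAlgebra

/-- Morphisms of `Alg_∇^H(D, C)`: all Heyting `∇`-algebra morphisms. -/
@[ext] structure Hom (A B : HNablaAlg.{u} C) where
  hom : HeytingNablaHom A B

instance : Category (HNablaAlg.{u} C) where
  Hom := Hom
  id A := ⟨HeytingNablaHom.id A⟩
  comp f g := ⟨g.hom.comp f.hom⟩

end HNablaAlg

/-! ### Spaces -/

/-- A Kripke frame: a poset with a compatible binary relation. -/
class KripkeFrame (W : Type u) [PartialOrder W] where
  rel : W → W → Prop
  rel_of_le : ∀ {k' k l l' : W}, k' ≤ k → rel k l → l ≤ l' → rel k' l'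

open KripkeFrame (rel rel_of_le)

/-- An Esakia space: a Priestley space in which the downset of every clopen set is clopen. -/
class EsakiaSpace (X : Type u) [TopologicalSpace X] [PartialOrder X] : Prop
    extends CompactSpace X, PriestleySpace X where
  isClopen_downset : ∀ U : Set X, IsClopen U → IsClopen {x | ∃ y ∈ U, x ≤ y}

/-- A `∇`-space: a Priestley space with a suitable binary relation. -/
class NablaSpace (X : Type u) [TopologicalSpace X] [PartialOrder X]
    extends CompactSpace X, PriestleySpace X, KripkeFrame X where
  isClosed_rel : ∀ x : X, IsClosed {y | rel x y}
  isClopen_dia : ∀ U : Set X, IsClopen U → IsClopen {x | ∃ y ∈ U, rel x y}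
  clopenUpper_nabla : ∀ V : Set X, IsClopen V → IsUpperSet V →
    IsClopen {x | ∃ y ∈ V, rel y x} ∧ IsUpperSet {x | ∃ y ∈ V, rel y x}

/-- The meaning of each condition on a `∇`-space. -/
def NablaSpace.Satisfies (X : Type u) [TopologicalSpace X] [PartialOrder X] [NablaSpace X] :
    NablaCond → Prop
  | .N => ∃ π : X → X, Monotone π ∧ ∀ x y : X, rel x y ↔ x ≤ π y
  | .H => EsakiaSpace X
  | .R => ∀ x : X, rel x x
  | .L => ∀ x y : X, rel x y → x ≤ y
  | .Fa => ∀ x : X, ∃ y : X, rel y x ∧ ∀ z : X, rel y z → x ≤ z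
  | .Fu => ∀ x : X, ∃ y : X, rel x y ∧ ∀ z : X, rel z y → z ≤ x

/-- A `∇`-space map: a continuous Kripke morphism. -/
structure NablaSpaceMap (X Y : Type u) [TopologicalSpace X] [PartialOrder X] [NablaSpace X]
    [TopologicalSpace Y] [PartialOrder Y] [NablaSpace Y] extends ContinuousOrderHom X Y where
  map_rel' : ∀ k l : X, rel k l → rel (toFun k) (toFun l)
  exists_rel_right' : ∀ (k : X) (l' : Y), rel (toFun k) l' → ∃ l, rel k l ∧ toFun l = l'
  exists_rel_left' : ∀ (k : X) (l' : Y), rel l' (toFun k) → ∃ l, rel l k ∧ l' ≤ toFun l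

namespace NablaSpaceMap

variable {X Y Z : Type u} [TopologicalSpace X] [PartialOrder X] [NablaSpace X]
  [TopologicalSpace Y] [PartialOrder Y] [NablaSpace Y]
  [TopologicalSpace Z] [PartialOrder Z] [NablaSpace Z]

instance : FunLike (NablaSpaceMap X Y) X Y where
  coe f := f.toFun
  coe_injective f g h := by
    obtain ⟨f, _, _, _⟩ := f
    obtain ⟨g, _, _, _⟩ := g
    congr
    exact DFunLike.coe_injective h

@[ext] theorem ext {f g : NablaSpaceMap X Y} (h : ∀ a, f a = g a) : f = g := DFunLike.ext _ _ h

theorem monotone (f : NablaSpaceMap X Y) : Monotone f := f.monotone'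
theorem continuous (f : NablaSpaceMap X Y) : Continuous f := f.continuous_toFun
theorem map_rel (f : NablaSpaceMap X Y) {k l : X} (h : rel k l) : rel (f k) (f l) :=
  f.map_rel' k l h
theorem exists_rel_right (f : NablaSpaceMap X Y) {k : X} {l' : Y} (h : rel (f k) l') :
    ∃ l, rel k l ∧ f l = l' := f.exists_rel_right' k l' h
theorem exists_rel_left (f : NablaSpaceMap X Y) {k : X} {l' : Y} (h : rel l' (f k)) :
    ∃ l, rel l k ∧ l' ≤ f l := f.exists_rel_left' k l' h

/-- The identity map. -/
def id (X : Type u) [TopologicalSpace X] [PartialOrder X] [NablaSpace X] :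
    NablaSpaceMap X X where
  toContinuousOrderHom := ContinuousOrderHom.id X
  map_rel' _ _ h := h
  exists_rel_right' _ l' h := ⟨l', h, rfl⟩
  exists_rel_left' _ l' h := ⟨l', h, le_refl l'⟩

/-- Composition of maps. -/
def comp (g : NablaSpaceMap Y Z) (f : NablaSpaceMap X Y) : NablaSpaceMap X Z where
  toContinuousOrderHom := g.toContinuousOrderHom.comp f.toContinuousOrderHom
  map_rel' _ _ h := g.map_rel (f.map_rel h)
  exists_rel_right' k l'' h := by
    obtain ⟨l', h', rfl⟩ := g.exists_rel_right (k := f k) h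
    obtain ⟨l, hl, rfl⟩ := f.exists_rel_right h'
    exact ⟨l, hl, rfl⟩
  exists_rel_left' k l'' h := by
    obtain ⟨l', h', hl'⟩ := g.exists_rel_left (k := f k) h
    obtain ⟨l, h, hl⟩ := f.exists_rel_left h'
    exact ⟨l, h, hl'.trans (g.monotone hl)⟩

end NablaSpaceMap

/-- A Heyting `∇`-space map. -/
structure HeytingNablaSpaceMap (X Y : Type u) [TopologicalSpace X] [PartialOrder X]
    [NablaSpace X] [TopologicalSpace Y] [PartialOrder Y] [NablaSpace Y]
    extends NablaSpaceMap X Y where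
  exists_le' : ∀ (k : X) (l' : Y), toFun k ≤ l' → ∃ l, k ≤ l ∧ toFun l = l'

namespace HeytingNablaSpaceMap

variable {X Y Z : Type u} [TopologicalSpace X] [PartialOrder X] [NablaSpace X]
  [TopologicalSpace Y] [PartialOrder Y] [NablaSpace Y]
  [TopologicalSpace Z] [PartialOrder Z] [NablaSpace Z]

instance : FunLike (HeytingNablaSpaceMap X Y) X Y where
  coe f := f.toFun
  coe_injective f g h := by
    obtain ⟨f, _⟩ := f
    obtain ⟨g, _⟩ := g
    congr
    exact DFunLike.coe_injective h

@[ext] theorem ext {f g : HeytingNablaSpaceMap X Y} (h : ∀ a, f a = g a) : f = g :=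
  DFunLike.ext _ _ h

theorem exists_le (f : HeytingNablaSpaceMap X Y) {k : X} {l' : Y} (h : f k ≤ l') :
    ∃ l, k ≤ l ∧ f l = l' := f.exists_le' k l' h

/-- The identity map. -/
def id (X : Type u) [TopologicalSpace X] [PartialOrder X] [NablaSpace X] :
    HeytingNablaSpaceMap X X where
  toNablaSpaceMap := NablaSpaceMap.id X
  exists_le' _ l' h := ⟨l', h, rfl⟩

/-- Composition of maps. -/
def comp (g : HeytingNablaSpaceMap Y Z) (f : HeytingNablaSpaceMap X Y) :
    HeytingNablaSpaceMap X Z where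
  toNablaSpaceMap := g.toNablaSpaceMap.comp f.toNablaSpaceMap
  exists_le' k l'' h := by
    obtain ⟨l', h', rfl⟩ := g.exists_le (k := f k) h
    obtain ⟨l, hl, rfl⟩ := f.exists_le h'
    exact ⟨l, hl, rfl⟩

end HeytingNablaSpaceMap

/-- The objects of `Space_∇(C)`: `∇`-spaces satisfying the conditions in `C`. -/
structure NablaSp (C : Set NablaCond) where
  carrier : Type u
  [topologicalSpace : TopologicalSpace carrier]
  [partialOrder : PartialOrder carrier]
  [nablaSpace : NablaSpace carrier]
  satisfies : ∀ c ∈ C, NablaSpace.Satisfies carrier c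

namespace NablaSp

variable {C : Set NablaCond}

instance : CoeSort (NablaSp.{u} C) (Type u) := ⟨carrier⟩

attribute [instance] topologicalSpace partialOrder nablaSpace

/-- Morphisms of `Space_∇(C)`: all `∇`-space maps. -/
@[ext] structure Hom (X Y : NablaSp.{u} C) where
  hom : NablaSpaceMap X Y

instance : Category (NablaSp.{u} C) where
  Hom := Hom
  id X := ⟨NablaSpaceMap.id X⟩
  comp f g := ⟨g.hom.comp f.hom⟩

end NablaSp

/-- The objects of `Space_∇^H(C)`: Heyting `∇`-spaces satisfying the conditions in `C`. -/
structure HNablaSp (C : Set NablaCond) where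
  carrier : Type u
  [topologicalSpace : TopologicalSpace carrier]
  [partialOrder : PartialOrder carrier]
  [nablaSpace : NablaSpace carrier]
  [esakiaSpace : EsakiaSpace carrier]
  satisfies : ∀ c ∈ C, NablaSpace.Satisfies carrier c

namespace HNablaSp

variable {C : Set NablaCond}

instance : CoeSort (HNablaSp.{u} C) (Type u) := ⟨carrier⟩

attribute [instance] topologicalSpace partialOrder nablaSpace esakiaSpace

/-- Morphisms of `Space_∇^H(C)`: all Heyting `∇`-space maps. -/
@[ext] structure Hom (X Y : HNablaSp.{u} C) where
  hom : HeytingNablaSpaceMap X Y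

instance : Category (HNablaSp.{u} C) where
  Hom := Hom
  id X := ⟨HeytingNablaSpaceMap.id X⟩
  comp f g := ⟨g.hom.comp f.hom⟩

end HNablaSp

/-! ### From spaces to algebras: clopen upsets -/

instance (X : Type u) [TopologicalSpace X] [PartialOrder X] :
    DistribLattice (ClopenUpperSet X) where
  le_sup_inf U V W := (Set.union_inter_distrib_left (U : Set X) V W).ge

section ClopenUpsets

variable (X : Type u) [TopologicalSpace X] [PartialOrder X]

/-- The `∇`-algebra of clopen upsets: `∇_R(U) = {x | ∃ y ∈ U, (y, x) ∈ R}` and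
`U →_R V = {x | R[x] ∩ U ⊆ V}`. -/
instance clopenUpsetNablaAlgebra [NablaSpace X] : NablaAlgebra (ClopenUpperSet X) where
  nabla U := ⟨⟨{x | ∃ y ∈ U, rel y x}, (NablaSpace.clopenUpper_nabla _ U.isClopen U.upper).1⟩,
    (NablaSpace.clopenUpper_nabla _ U.isClopen U.upper).2⟩
  imp U V := ⟨⟨{x | {y | rel x y} ∩ U ⊆ V}, by
      have h := (NablaSpace.isClopen_dia _ (U.isClopen.inter V.isClopen.compl)).compl
      convert h using 1
      ext x
      simp only [Set.subset_def, Set.mem_inter_iff, Set.mem_compl_iff, Set.mem_ofPred_eq,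
        not_exists, not_and]
      constructor
      · intro h y hy hr
        exact hy.2 (h y ⟨hr, hy.1⟩)
      · intro h y hy
        by_contra hV
        exact h y ⟨hy.2, hV⟩ hy.1⟩,
    fun _ _ hxy hx _ hz => hx ⟨rel_of_le hxy hz.1 le_rfl, hz.2⟩⟩
  nabla_inf_le_iff U V W := by
    constructor
    · intro h x hx _ hy
      exact h ⟨⟨x, hx, hy.1⟩, hy.2⟩
    · rintro h y ⟨⟨x, hx, hr⟩, hy⟩
      exact h hx ⟨hr, hy⟩

variable {X}

theorem mem_nabla_iff [NablaSpace X] {U : ClopenUpperSet X} {x : X} :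
    x ∈ nabla U ↔ ∃ y ∈ U, rel y x := Iff.rfl

theorem mem_imp_iff [NablaSpace X] {U V : ClopenUpperSet X} {x : X} :
    x ∈ imp U V ↔ ∀ y, rel x y → y ∈ U → y ∈ V :=
  ⟨fun h _ h₁ h₂ => h ⟨h₁, h₂⟩, fun h y hy => h y hy.1 hy.2⟩

/-- The complement of `↓(U \ V)`, which is the Heyting implication of clopen upsets. -/
def clopenUpsetHimp [EsakiaSpace X] (U V : ClopenUpperSet X) : ClopenUpperSet X :=
  ⟨⟨{x | ∃ y ∈ (U : Set X) \ V, x ≤ y}ᶜ,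
      (EsakiaSpace.isClopen_downset _ (U.isClopen.diff V.isClopen)).compl⟩,
    fun _ _ hxy hx ⟨z, hz, hyz⟩ => hx ⟨z, hz, hxy.trans hyz⟩⟩

theorem mem_clopenUpsetHimp [EsakiaSpace X] {U V : ClopenUpperSet X} {x : X} :
    x ∈ clopenUpsetHimp U V ↔ ∀ y, x ≤ y → y ∈ U → y ∈ V := by
  change ¬ (∃ y ∈ (U : Set X) \ V, x ≤ y) ↔ _
  constructor
  · intro h y hy hU
    by_contra hV
    exact h ⟨y, ⟨hU, hV⟩, hy⟩
  · rintro h ⟨y, ⟨hU, hV⟩, hy⟩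
    exact hV (h y hy hU)

theorem le_clopenUpsetHimp_iff [EsakiaSpace X] (U V W : ClopenUpperSet X) :
    U ≤ clopenUpsetHimp V W ↔ U ⊓ V ≤ W := by
  constructor
  · rintro h x ⟨hU, hV⟩
    exact mem_clopenUpsetHimp.1 (h hU) x le_rfl hV
  · intro h x hU
    exact mem_clopenUpsetHimp.2 fun y hy hV => h ⟨U.upper hy hU, hV⟩

/-- The clopen upsets of an Esakia space form a Heyting algebra. -/
instance clopenUpsetHeytingAlgebra [EsakiaSpace X] : HeytingAlgebra (ClopenUpperSet X) where
  __ := (inferInstance : DistribLattice (ClopenUpperSet X))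
  __ := (inferInstance : BoundedOrder (ClopenUpperSet X))
  himp := clopenUpsetHimp
  le_himp_iff := le_clopenUpsetHimp_iff
  compl U := clopenUpsetHimp U ⊥
  himp_bot _ := rfl

theorem clopenUpset_satisfies [NablaSpace X] (c : NablaCond) (h : NablaSpace.Satisfies X c) :
    NablaAlgebra.Satisfies (ClopenUpperSet X) c := by
  cases c with
  | N =>
    obtain ⟨π, hπ, hR⟩ := h
    have key : ∀ (U : ClopenUpperSet X) (x : X), x ∈ nabla U ↔ π x ∈ U := fun U x =>
      ⟨fun ⟨y, hy, hr⟩ => U.upper ((hR y x).1 hr) hy, fun h => ⟨π x, h, (hR _ _).2 le_rfl⟩⟩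
    refine ⟨?_, fun U V => ?_⟩
    · refine SetLike.ext fun x => ?_
      rw [key]
      exact Iff.rfl
    · refine SetLike.ext fun x => ?_
      rw [key]
      exact (and_congr (key U x) (key V x)).symm
  | H =>
    have : EsakiaSpace X := h
    exact fun U V => ⟨clopenUpsetHimp U V, fun W => le_clopenUpsetHimp_iff W U V⟩
  | R => exact fun U x hx => ⟨x, hx, h x⟩
  | L => exact fun U x ⟨y, hy, hr⟩ => U.upper (h y x hr) hy
  | Fa =>
    refine fun U => ⟨box U, SetLike.ext fun x => ⟨?_, fun hx => ?_⟩⟩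
    · rintro ⟨y, hy, hr⟩
      exact mem_imp_iff.1 hy x hr trivial
    · obtain ⟨y, hyx, hy⟩ := h x
      exact ⟨y, mem_imp_iff.2 fun z hz _ => U.upper (hy z hz) hx, hyx⟩
  | Fu =>
    refine fun U => ⟨nabla U, SetLike.ext fun x => ⟨fun hx => ?_, fun hx => ?_⟩⟩
    · obtain ⟨y, hxy, hy⟩ := h x
      obtain ⟨z, hz, hr⟩ := mem_imp_iff.1 hx y hxy trivial
      exact U.upper (hy z hr) hz
    · exact mem_imp_iff.2 fun y hy _ => ⟨x, hx, hy⟩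

variable {Y : Type u} [TopologicalSpace Y] [PartialOrder Y]

/-- The inverse image morphism of a `∇`-space map. -/
def preimageHom [NablaSpace X] [NablaSpace Y] (f : NablaSpaceMap X Y) :
    NablaHom (ClopenUpperSet Y) (ClopenUpperSet X) where
  toFun U := ⟨⟨f ⁻¹' U, U.isClopen.preimage f.continuous⟩, U.upper.preimage f.monotone⟩
  map_sup' _ _ := rfl
  map_inf' _ _ := rfl
  map_top' := rfl
  map_bot' := rfl
  map_nabla' U := by
    refine SetLike.ext fun x => ⟨?_, ?_⟩
    · rintro ⟨l', hl', hr⟩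
      obtain ⟨l, hl, hle⟩ := f.exists_rel_left hr
      exact ⟨l, U.upper hle hl', hl⟩
    · rintro ⟨l, hl, hr⟩
      exact ⟨f l, hl, f.map_rel hr⟩
  map_imp' U V := by
    refine SetLike.ext fun x => ⟨fun h => mem_imp_iff.2 fun y hr hy =>
      (mem_imp_iff (x := f x)).1 h (f y) (f.map_rel hr) hy, fun h => ?_⟩
    refine (mem_imp_iff (x := f x)).2 fun y' hr hy => ?_
    obtain ⟨y, hxy, rfl⟩ := f.exists_rel_right hr
    exact mem_imp_iff.1 h y hxy hy

/-- The inverse image morphism of a Heyting `∇`-space map. -/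
def heytingPreimageHom [NablaSpace X] [EsakiaSpace X] [NablaSpace Y] [EsakiaSpace Y]
    (f : HeytingNablaSpaceMap X Y) :
    HeytingNablaHom (ClopenUpperSet Y) (ClopenUpperSet X) where
  toNablaHom := preimageHom f.toNablaSpaceMap
  map_himp' U V := by
    refine SetLike.ext fun x => ⟨fun h => mem_clopenUpsetHimp.2 fun y hr hy =>
      (mem_clopenUpsetHimp (x := f x)).1 h (f y) (f.toNablaSpaceMap.monotone hr) hy, fun h => ?_⟩
    refine (mem_clopenUpsetHimp (x := f x)).2 fun y' hr hy => ?_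
    obtain ⟨y, hxy, rfl⟩ := f.exists_le hr
    exact mem_clopenUpsetHimp.1 h y hxy hy

end ClopenUpsets

/-- The functor `𝔄 : Space_∇(C)ᵒᵖ ⥤ Alg_∇(D, C)`: clopen upsets and inverse images. -/
def clopenUpsetFunctor (C : Set NablaCond) : (NablaSp.{u} C)ᵒᵖ ⥤ DNablaAlg.{u} C where
  obj X :=
    { carrier := ClopenUpperSet X.unop
      satisfies := fun c hc => clopenUpset_satisfies c (X.unop.satisfies c hc) }
  map f := ⟨preimageHom f.unop.hom⟩

/-- The functor `𝔄 : Space_∇^H(C)ᵒᵖ ⥤ Alg_∇^H(D, C)`. -/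
def heytingClopenUpsetFunctor (C : Set NablaCond) : (HNablaSp.{u} C)ᵒᵖ ⥤ HNablaAlg.{u} C where
  obj X :=
    { carrier := ClopenUpperSet X.unop
      satisfies := fun c hc => clopenUpset_satisfies c (X.unop.satisfies c hc) }
  map f := ⟨heytingPreimageHom f.unop.hom⟩

/-! ### From algebras to spaces: prime filters -/

/-- The poset of prime filters of a lattice, ordered by inclusion. Prime filters are proper. -/
def PrimeFilter (A : Type u) [Lattice A] : Type u := {F : Order.PFilter A // F.IsPrime}

namespace PrimeFilter

section Lattice

variable {A : Type u} [Lattice A]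

instance : SetLike (PrimeFilter A) A where
  coe P := P.1
  coe_injective _ _ h := Subtype.ext (SetLike.coe_injective h)

instance : PartialOrder (PrimeFilter A) := PartialOrder.ofSetLike (PrimeFilter A) A

/-- The Priestley topology. -/
instance : TopologicalSpace (PrimeFilter A) :=
  TopologicalSpace.generateFrom {s | ∃ a b : A, s = {P | a ∈ P ∧ b ∉ P}}

theorem mem_of_le (P : PrimeFilter A) {a b : A} (h : a ≤ b) (ha : a ∈ P) : b ∈ P :=
  Order.PFilter.mem_of_le (F := P.1) h ha

theorem inf_mem_iff (P : PrimeFilter A) {a b : A} : a ⊓ b ∈ P ↔ a ∈ P ∧ b ∈ P :=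
  Order.PFilter.inf_mem_iff (F := P.1)

theorem sup_mem_iff (P : PrimeFilter A) {a b : A} : a ⊔ b ∈ P ↔ a ∈ P ∨ b ∈ P := by
  constructor
  · intro h
    by_contra! hab
    exact (P.2.compl_ideal.toIdeal).sup_mem (x := a) (y := b) hab.1 hab.2 h
  · rintro (h | h)
    · exact P.mem_of_le le_sup_left h
    · exact P.mem_of_le le_sup_right h

theorem isOpen_basic (a b : A) : IsOpen {P : PrimeFilter A | a ∈ P ∧ b ∉ P} :=
  TopologicalSpace.isOpen_generateFrom_of_mem ⟨a, b, rfl⟩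

variable [BoundedOrder A]

theorem top_mem (P : PrimeFilter A) : ⊤ ∈ P := Order.PFilter.top_mem (F := P.1)

theorem bot_notMem (P : PrimeFilter A) : ⊥ ∉ P :=
  (P.2.compl_ideal.toIdeal).bot_mem

/-- The prime filter with the given elements. -/
def ofSet (F : Set A) (top : ⊤ ∈ F) (bot : ⊥ ∉ F)
    (inf : ∀ a b, a ⊓ b ∈ F ↔ a ∈ F ∧ b ∈ F) (sup : ∀ a b, a ⊔ b ∈ F ↔ a ∈ F ∨ b ∈ F) :
    PrimeFilter A :=
  ⟨(Order.IsPFilter.of_def (F := F) ⟨⊤, top⟩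
      (fun a ha b hb => ⟨a ⊓ b, (inf a b).2 ⟨ha, hb⟩, inf_le_left, inf_le_right⟩)
      (fun {a b} h ha => ((inf a b).1 (by rwa [inf_eq_left.2 h])).2)).toPFilter,
    ⟨⟨fun a b h hb ha => hb (by
        rw [← sup_eq_right.2 h]
        exact (sup b a).2 (Or.inl ha)), ⟨⊥, bot⟩,
      fun a ha b hb => ⟨a ⊔ b, fun h => ((sup a b).1 h).elim ha hb, le_sup_left, le_sup_right⟩⟩⟩⟩

theorem mem_ofSet {F : Set A} {top bot inf sup} {a : A} :
    a ∈ ofSet F top bot inf sup ↔ a ∈ F := Iff.rfl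

theorem isClopen_basic (a : A) : IsClopen {P : PrimeFilter A | a ∈ P} := by
  constructor
  · rw [← isOpen_compl_iff]
    convert isOpen_basic (⊤ : A) a using 1
    ext P
    simp [P.top_mem]
  · convert isOpen_basic a (⊥ : A) using 1
    ext P
    simp [P.bot_notMem]

instance : PriestleySpace (PrimeFilter A) where
  priestley {P Q} h := by
    obtain ⟨a, ha, hb⟩ := Set.not_subset.1 h
    exact ⟨{P | a ∈ P}, isClopen_basic a, fun _ _ h₁ h₂ => h₁ h₂, ha, hb⟩

instance : CompactSpace (PrimeFilter A) where
  isCompact_univ := by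
    rw [isCompact_iff_ultrafilter_le_nhds]
    intro 𝓤 _
    let P : PrimeFilter A := ofSet {a | {P : PrimeFilter A | a ∈ P} ∈ 𝓤}
      (by
        have h : {P : PrimeFilter A | ⊤ ∈ P} = Set.univ := by
          ext P
          simp [P.top_mem]
        change {P : PrimeFilter A | ⊤ ∈ P} ∈ 𝓤
        rw [h]
        exact Filter.univ_mem)
      (by
        have h : {P : PrimeFilter A | ⊥ ∈ P} = ∅ := by
          ext P
          simp [P.bot_notMem]
        change ¬ ({P : PrimeFilter A | ⊥ ∈ P} ∈ 𝓤)
        rw [h]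
        exact 𝓤.empty_notMem)
      (fun a b => by
        simp only [Set.mem_ofPred_eq, inf_mem_iff]
        exact Filter.inter_mem_iff)
      (fun a b => by
        simp only [Set.mem_ofPred_eq, sup_mem_iff]
        exact Ultrafilter.union_mem_iff)
    refine ⟨P, trivial, ?_⟩
    rw [TopologicalSpace.nhds_generateFrom]
    refine le_iInf₂ fun s hs => ?_
    obtain ⟨hP, a, b, rfl⟩ := hs
    rw [Filter.le_principal_iff]
    have h₁ : {P : PrimeFilter A | a ∈ P} ∈ 𝓤 := hP.1
    have h₂ : {P : PrimeFilter A | b ∈ P}ᶜ ∈ 𝓤 := Ultrafilter.compl_mem_iff_notMem.2 hP.2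
    exact Filter.inter_mem h₁ h₂

theorem isTopologicalBasis : TopologicalSpace.IsTopologicalBasis
    (Set.range fun p : A × A => {P : PrimeFilter A | p.1 ∈ P ∧ p.2 ∉ P}) where
  exists_subset_inter := by
    rintro _ ⟨p, rfl⟩ _ ⟨q, rfl⟩ P hP
    refine ⟨_, ⟨(p.1 ⊓ q.1, p.2 ⊔ q.2), rfl⟩, ?_, fun Q hQ => ?_⟩
    · have := hP.1
      have := hP.2
      simp_all [inf_mem_iff, sup_mem_iff]
    · simp_all [inf_mem_iff, sup_mem_iff]
  sUnion_eq := by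
    refine Set.eq_univ_of_forall fun P => ⟨_, ⟨(⊤, ⊥), rfl⟩, P.top_mem, P.bot_notMem⟩
  eq_generateFrom := by
    change TopologicalSpace.generateFrom _ = _
    congr 1
    ext s
    simp [eq_comm]

/-- A family of sets that commutes with unions is clopen on clopen sets once it is so on the
basic sets. -/
theorem isClopen_of_basic (r : PrimeFilter A → PrimeFilter A → Prop)
    (h : ∀ a b : A, IsClopen {P | ∃ Q : PrimeFilter A, (a ∈ Q ∧ b ∉ Q) ∧ r P Q})
    (U : Set (PrimeFilter A)) (hU : IsClopen U) : IsClopen {P | ∃ Q ∈ U, r P Q} := by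
  obtain ⟨s, hs, rfl⟩ := eq_finite_iUnion_of_isTopologicalBasis_of_isCompact_open _
    isTopologicalBasis U hU.isClosed.isCompact hU.isOpen
  have : {P | ∃ Q ∈ ⋃ p ∈ s, {P : PrimeFilter A | p.1 ∈ P ∧ p.2 ∉ P}, r P Q} =
      ⋃ p ∈ s, {P | ∃ Q : PrimeFilter A, (p.1 ∈ Q ∧ p.2 ∉ Q) ∧ r P Q} := by
    ext P
    simp only [Set.mem_iUnion, Set.mem_ofPred_eq, exists_prop]
    constructor
    · rintro ⟨Q, ⟨p, hp, hQ⟩, hr⟩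
      exact ⟨p, hp, Q, hQ, hr⟩
    · rintro ⟨p, hp, Q, hQ, hr⟩
      exact ⟨Q, ⟨p, hp, hQ⟩, hr⟩
  rw [this]
  exact hs.isClopen_biUnion fun p _ => h p.1 p.2

end Lattice

section DistribLattice

variable {A : Type u} [DistribLattice A] [BoundedOrder A]

/-- The prime filter theorem. -/
theorem exists_of_disjoint (F I : Set A) (top : ⊤ ∈ F) (inf : ∀ a ∈ F, ∀ b ∈ F, a ⊓ b ∈ F)
    (bot : ⊥ ∈ I) (sup : ∀ a ∈ I, ∀ b ∈ I, a ⊔ b ∈ I)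
    (disj : ∀ a ∈ F, ∀ b ∈ I, ¬ a ≤ b) :
    ∃ P : PrimeFilter A, (∀ a ∈ F, a ∈ P) ∧ ∀ b ∈ I, b ∉ P := by
  let F' : Order.PFilter A := (Order.IsPFilter.of_def (F := {x | ∃ a ∈ F, a ≤ x}) ⟨⊤, ⊤, top, le_rfl⟩
    (by
      rintro x ⟨a, ha, hx⟩ y ⟨b, hb, hy⟩
      exact ⟨x ⊓ y, ⟨a ⊓ b, inf a ha b hb, inf_le_inf hx hy⟩, inf_le_left, inf_le_right⟩)
    (by
      rintro x y hxy ⟨a, ha, hx⟩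
      exact ⟨a, ha, hx.trans hxy⟩)).toPFilter
  let I' : Order.Ideal A := Order.IsIdeal.toIdeal (I := {x | ∃ a ∈ I, x ≤ a})
    ⟨by
      rintro x y hxy ⟨a, ha, hx⟩
      exact ⟨a, ha, hxy.trans hx⟩, ⟨⊥, ⊥, bot, le_rfl⟩, by
      rintro x ⟨a, ha, hx⟩ y ⟨b, hb, hy⟩
      exact ⟨x ⊔ y, ⟨a ⊔ b, sup a ha b hb, sup_le_sup hx hy⟩, le_sup_left, le_sup_right⟩⟩
  have hd : Disjoint (F' : Set A) (I' : Set A) := Set.disjoint_left.2 (by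
    rintro x ⟨a, ha, hx⟩ ⟨b, hb, hx'⟩
    exact disj a ha b hb (hx.trans hx'))
  obtain ⟨J, hJ, hIJ, hFJ⟩ := DistribLattice.prime_ideal_of_disjoint_filter_ideal hd
  refine ⟨⟨hJ.compl_filter.toPFilter, ⟨?_⟩⟩, fun a ha haJ => ?_, fun b hb h => ?_⟩
  · convert J.isIdeal
    exact compl_compl (J : Set A)
  · exact Set.disjoint_left.1 hFJ (show a ∈ (F' : Set A) from ⟨a, ha, le_rfl⟩) haJ
  · exact h (hIJ (show b ∈ I' from ⟨b, hb, le_rfl⟩))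

/-- A clopen upset of prime filters is of the form `{P | a ∈ P}`. -/
theorem exists_eq_of_clopenUpper (V : Set (PrimeFilter A)) (hV : IsClopen V)
    (hV' : IsUpperSet V) : ∃ a : A, V = {P | a ∈ P} := by
  have h₁ : ∀ P ∈ V, ∃ a : A, a ∈ P ∧ {Q : PrimeFilter A | a ∈ Q} ⊆ V := by
    intro P hP
    have : Nonempty {a // a ∈ P} := ⟨⟨⊤, P.top_mem⟩⟩
    obtain ⟨a, ha⟩ := hV.compl.isClosed.isCompact.elim_directed_cover
      (fun a : {a // a ∈ P} => {Q : PrimeFilter A | a.1 ∈ Q}ᶜ)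
      (fun a => (isClopen_basic a.1).compl.isOpen)
      (fun Q hQ => by
        obtain ⟨a, ha, hb⟩ := Set.not_subset.1 fun h : (P : Set A) ⊆ Q => hQ (hV' h hP)
        exact Set.mem_iUnion.2 ⟨⟨a, ha⟩, hb⟩)
      (fun a b => ⟨⟨a.1 ⊓ b.1, P.inf_mem_iff.2 ⟨a.2, b.2⟩⟩,
        fun Q hQ h => hQ (Q.inf_mem_iff.1 h).1, fun Q hQ h => hQ (Q.inf_mem_iff.1 h).2⟩)
    exact ⟨a.1, a.2, Set.compl_subset_compl.1 ha⟩
  have : Nonempty {a : A // {Q : PrimeFilter A | a ∈ Q} ⊆ V} :=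
    ⟨⟨⊥, fun Q hQ => (Q.bot_notMem hQ).elim⟩⟩
  obtain ⟨a, ha⟩ := hV.isClosed.isCompact.elim_directed_cover
    (fun a : {a : A // {Q : PrimeFilter A | a ∈ Q} ⊆ V} => {Q : PrimeFilter A | a.1 ∈ Q})
    (fun a => (isClopen_basic a.1).isOpen)
    (fun P hP => by
      obtain ⟨a, ha, hV⟩ := h₁ P hP
      exact Set.mem_iUnion.2 ⟨⟨a, hV⟩, ha⟩)
    (fun a b => ⟨⟨a.1 ⊔ b.1, fun Q hQ => (Q.sup_mem_iff.1 hQ).elim (@a.2 Q) (@b.2 Q)⟩,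
      fun Q hQ => Q.sup_mem_iff.2 (Or.inl hQ), fun Q hQ => Q.sup_mem_iff.2 (Or.inr hQ)⟩)
  exact ⟨a.1, ha.antisymm a.2⟩

end DistribLattice

section Adjoint

variable {A : Type u} [DistribLattice A] [BoundedOrder A] {n : A → A} {i : A → A → A}

theorem adj_mono (adj : ∀ a b c : A, n c ⊓ a ≤ b ↔ c ≤ i a b) : Monotone n := fun a b h => by
  have := (adj ⊤ (n b) a).2 (h.trans ((adj ⊤ (n b) b).1 inf_le_left))
  simpa using this

theorem adj_bot (adj : ∀ a b c : A, n c ⊓ a ≤ b ↔ c ≤ i a b) : n ⊥ = ⊥ := by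
  have := (adj ⊤ ⊥ ⊥).2 bot_le
  simpa using this

theorem adj_sup (adj : ∀ a b c : A, n c ⊓ a ≤ b ↔ c ≤ i a b) (a b : A) :
    n (a ⊔ b) = n a ⊔ n b := by
  apply le_antisymm
  · have := (adj ⊤ (n a ⊔ n b) (a ⊔ b)).2 (sup_le ((adj _ _ _).1 (inf_le_left.trans le_sup_left))
      ((adj _ _ _).1 (inf_le_left.trans le_sup_right)))
    simpa using this
  · exact sup_le (adj_mono adj le_sup_left) (adj_mono adj le_sup_right)

theorem adj_imp_mem_iff (adj : ∀ a b c : A, n c ⊓ a ≤ b ↔ c ≤ i a b) (a b : A)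
    (P : PrimeFilter A) :
    i a b ∈ P ↔ ∀ Q : PrimeFilter A, (∀ c ∈ P, n c ∈ Q) → a ∈ Q → b ∈ Q := by
  constructor
  · intro h Q hQ ha
    exact Q.mem_of_le ((adj a b _).2 le_rfl) (Q.inf_mem_iff.2 ⟨hQ _ h, ha⟩)
  · intro h
    by_contra hab
    obtain ⟨Q, hF, hI⟩ := exists_of_disjoint {x | ∃ c ∈ P, n c ⊓ a ≤ x} {x | x ≤ b}
      ⟨⊤, P.top_mem, le_top⟩
      (by
        rintro x ⟨c, hc, hx⟩ y ⟨d, hd, hy⟩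
        refine ⟨c ⊓ d, P.inf_mem_iff.2 ⟨hc, hd⟩, le_inf (le_trans ?_ hx) (le_trans ?_ hy)⟩
        · exact inf_le_inf_right _ (adj_mono adj inf_le_left)
        · exact inf_le_inf_right _ (adj_mono adj inf_le_right))
      bot_le (fun _ h₁ _ h₂ => sup_le h₁ h₂)
      (by
        rintro x ⟨c, hc, hx⟩ y hy hxy
        exact hab (P.mem_of_le ((adj a b c).1 (hx.trans (hxy.trans hy))) hc))
    exact hI b le_rfl (h Q (fun c hc => hF _ ⟨c, hc, inf_le_left⟩) (hF _ ⟨⊤, P.top_mem, inf_le_right⟩))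

theorem adj_mem_iff (adj : ∀ a b c : A, n c ⊓ a ≤ b ↔ c ≤ i a b) (a : A)
    (Q : PrimeFilter A) :
    n a ∈ Q ↔ ∃ P : PrimeFilter A, a ∈ P ∧ ∀ c ∈ P, n c ∈ Q := by
  constructor
  · intro h
    obtain ⟨P, hF, hI⟩ := exists_of_disjoint {x | a ≤ x} {x | n x ∉ Q}
      le_top (fun _ h₁ _ h₂ => le_inf h₁ h₂)
      (by
        change n ⊥ ∉ Q
        rw [adj_bot adj]
        exact Q.bot_notMem)
      (fun x hx y hy => by
        change n (x ⊔ y) ∉ Q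
        rw [adj_sup adj, sup_mem_iff]
        exact not_or.2 ⟨hx, hy⟩)
      (fun x hx y hy hxy => hy (Q.mem_of_le (adj_mono adj (le_trans hx hxy)) h))
    exact ⟨P, hF a le_rfl, fun c hc => by_contra fun h => hI c h hc⟩
  · rintro ⟨P, ha, h⟩
    exact h a ha

theorem adj_isClopen (adj : ∀ a b c : A, n c ⊓ a ≤ b ↔ c ≤ i a b) (U : Set (PrimeFilter A))
    (hU : IsClopen U) : IsClopen {P : PrimeFilter A | ∃ Q ∈ U, ∀ c ∈ P, n c ∈ Q} := by
  refine isClopen_of_basic (fun P Q : PrimeFilter A => ∀ c ∈ P, n c ∈ Q) (fun a b => ?_) U hU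
  convert (isClopen_basic (i a b)).compl using 1
  ext P
  change _ ↔ ¬ (i a b ∈ P)
  rw [adj_imp_mem_iff adj]
  constructor
  · rintro ⟨Q, ⟨ha, hb⟩, hQ⟩ h
    exact hb (h Q hQ ha)
  · intro h
    by_contra hn
    exact h fun Q hQ ha => by_contra fun hb => hn ⟨Q, ⟨ha, hb⟩, hQ⟩

variable {B : Type u} [DistribLattice B] [BoundedOrder B] {m : B → B} {j : B → B → B}

theorem adj_exists_right (adjA : ∀ a b c : A, n c ⊓ a ≤ b ↔ c ≤ i a b)
    (adjB : ∀ a b c : B, m c ⊓ a ≤ b ↔ c ≤ j a b) (f : BoundedLatticeHom A B)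
    (hf : ∀ a b, f (i a b) = j (f a) (f b)) (P : PrimeFilter B) (L' : PrimeFilter A)
    (h : ∀ a, f a ∈ P → n a ∈ L') :
    ∃ L : PrimeFilter B, (∀ c ∈ P, m c ∈ L) ∧ ∀ a, f a ∈ L ↔ a ∈ L' := by
  obtain ⟨L, hF, hI⟩ := exists_of_disjoint {x | ∃ c ∈ P, ∃ a ∈ L', m c ⊓ f a ≤ x}
    {x | ∃ b ∉ L', x = f b} ⟨⊤, P.top_mem, ⊤, L'.top_mem, le_top⟩
    (by
      rintro x ⟨c, hc, a, ha, hx⟩ y ⟨d, hd, b, hb, hy⟩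
      refine ⟨c ⊓ d, P.inf_mem_iff.2 ⟨hc, hd⟩, a ⊓ b, L'.inf_mem_iff.2 ⟨ha, hb⟩,
        le_inf (le_trans ?_ hx) (le_trans ?_ hy)⟩
      · exact inf_le_inf (adj_mono adjB inf_le_left) (OrderHomClass.mono f inf_le_left)
      · exact inf_le_inf (adj_mono adjB inf_le_right) (OrderHomClass.mono f inf_le_right))
    ⟨⊥, L'.bot_notMem, (map_bot f).symm⟩
    (by
      rintro _ ⟨a, ha, rfl⟩ _ ⟨b, hb, rfl⟩
      exact ⟨a ⊔ b, fun h => (L'.sup_mem_iff.1 h).elim ha hb, (map_sup f a b).symm⟩)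
    (by
      rintro x ⟨c, hc, a, ha, hx⟩ _ ⟨b, hb, rfl⟩ hxy
      have h₁ : c ≤ f (i a b) := by
        rw [hf]
        exact (adjB _ _ _).1 (hx.trans hxy)
      have h₂ := h _ (P.mem_of_le h₁ hc)
      exact hb (L'.mem_of_le ((adjA a b _).2 le_rfl) (L'.inf_mem_iff.2 ⟨h₂, ha⟩)))
  refine ⟨L, fun c hc => hF _ ⟨c, hc, ⊤, L'.top_mem, inf_le_left⟩, fun a => ⟨fun ha => ?_,
    fun ha => hF _ ⟨⊤, P.top_mem, a, ha, inf_le_right⟩⟩⟩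
  by_contra hn
  exact hI _ ⟨a, hn, rfl⟩ ha

theorem adj_exists_left (adjB : ∀ a b c : B, m c ⊓ a ≤ b ↔ c ≤ j a b)
    (f : BoundedLatticeHom A B)
    (hf : ∀ a, f (n a) = m (f a)) (P : PrimeFilter B) (L' : PrimeFilter A)
    (h : ∀ a ∈ L', f (n a) ∈ P) :
    ∃ L : PrimeFilter B, (∀ c ∈ L, m c ∈ P) ∧ ∀ a ∈ L', f a ∈ L := by
  obtain ⟨L, hF, hI⟩ := exists_of_disjoint {x | ∃ a ∈ L', x = f a} {x | m x ∉ P}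
    ⟨⊤, L'.top_mem, (map_top f).symm⟩
    (by
      rintro _ ⟨a, ha, rfl⟩ _ ⟨b, hb, rfl⟩
      exact ⟨a ⊓ b, L'.inf_mem_iff.2 ⟨ha, hb⟩, (map_inf f a b).symm⟩)
    (by
      change m ⊥ ∉ P
      rw [adj_bot adjB]
      exact P.bot_notMem)
    (fun x hx y hy => by
      change m (x ⊔ y) ∉ P
      rw [adj_sup adjB, sup_mem_iff]
      exact not_or.2 ⟨hx, hy⟩)
    (by
      rintro _ ⟨a, ha, rfl⟩ y hy hxy
      refine hy (P.mem_of_le (adj_mono adjB hxy) ?_)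
      rw [← hf]
      exact h a ha)
  exact ⟨L, fun c hc => by_contra fun h => hI c h hc, fun a ha => hF _ ⟨a, ha, rfl⟩⟩

end Adjoint

section NablaAlgebra

variable {A : Type u} [DistribLattice A] [BoundedOrder A] [NablaAlgebra A]

/-- The `∇`-space of prime filters, with `(P, Q) ∈ R` iff `∇[P] ⊆ Q`. -/
instance primeFilterNablaSpace : NablaSpace (PrimeFilter A) where
  rel P Q := nabla '' (P : Set A) ⊆ Q
  rel_of_le h₁ h h₂ := (Set.image_mono h₁).trans (h.trans h₂)
  isClosed_rel P := by
    have : {Q : PrimeFilter A | nabla '' (P : Set A) ⊆ Q} =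
        ⋂ a ∈ P, {Q : PrimeFilter A | nabla a ∈ Q} := by
      ext Q
      simp [Set.subset_def]
    rw [this]
    exact isClosed_biInter fun a _ => (isClopen_basic _).isClosed
  isClopen_dia U hU := by
    simp only [Set.image_subset_iff]
    exact adj_isClopen (nabla_inf_le_iff (A := A)) U hU
  clopenUpper_nabla V hV hV' := by
    obtain ⟨a, rfl⟩ := exists_eq_of_clopenUpper V hV hV'
    have : {Q : PrimeFilter A | ∃ P ∈ {P : PrimeFilter A | a ∈ P},
        nabla '' (P : Set A) ⊆ Q} = {Q | nabla a ∈ Q} := by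
      ext Q
      simp only [Set.image_subset_iff]
      exact (adj_mem_iff (nabla_inf_le_iff (A := A)) a Q).symm
    rw [this]
    exact ⟨isClopen_basic _, fun _ _ h₁ h₂ => h₁ h₂⟩

theorem rel_iff {P Q : PrimeFilter A} : rel P Q ↔ ∀ a ∈ P, nabla a ∈ Q := Set.image_subset_iff

theorem nabla_box_le (a : A) : nabla (box a) ≤ a := by
  simpa using (nabla_inf_le_iff (⊤ : A) a (box a)).2 le_rfl

theorem le_box_nabla (a : A) : a ≤ box (nabla a) := (nabla_inf_le_iff _ _ _).1 inf_le_left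

theorem le_box_iff {a b : A} : nabla a ≤ b ↔ a ≤ box b := by
  simpa [box] using nabla_inf_le_iff (⊤ : A) b a

theorem nabla_mono : Monotone (nabla : A → A) := adj_mono nabla_inf_le_iff

theorem satisfies (c : NablaCond) (h : NablaAlgebra.Satisfies A c) :
    NablaSpace.Satisfies (PrimeFilter A) c := by
  cases c with
  | N =>
    obtain ⟨htop, hinf⟩ := h
    refine ⟨fun Q => ofSet {a | nabla a ∈ Q} ?_ ?_ ?_ ?_, ?_, ?_⟩
    · simp [htop, Q.top_mem]
    · simp [adj_bot (nabla_inf_le_iff (A := A)), Q.bot_notMem]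
    · simp [hinf, inf_mem_iff]
    · simp [adj_sup (nabla_inf_le_iff (A := A)), sup_mem_iff]
    · exact fun P Q hPQ a ha => hPQ ha
    · exact fun P Q => rel_iff
  | H =>
    choose i hi using h
    have adj : ∀ a b c : A, _root_.id c ⊓ a ≤ b ↔ c ≤ i a b := fun a b c => (hi a b c).symm
    exact ⟨fun U hU => adj_isClopen adj U hU⟩
  | R => exact fun P => rel_iff.2 fun a ha => P.mem_of_le (h a) ha
  | L => exact fun P Q hPQ a ha => Q.mem_of_le (h a) (rel_iff.1 hPQ a ha)
  | Fa =>
    intro P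
    have hs : ∀ a : A, nabla (box a) = a := fun a => by
      obtain ⟨b, rfl⟩ := h a
      exact le_antisymm (nabla_box_le _) (nabla_mono (le_box_nabla _))
    obtain ⟨Q, hF, hI⟩ := exists_of_disjoint {x | ∃ a ∈ P, x = box a} {x : A | nabla x ∉ P}
      ⟨⊤, P.top_mem, top_le_iff.1 (le_box_iff.1 le_top) |>.symm⟩
      (by
        rintro _ ⟨a, ha, rfl⟩ _ ⟨b, hb, rfl⟩
        refine ⟨a ⊓ b, P.inf_mem_iff.2 ⟨ha, hb⟩, le_antisymm ?_ ?_⟩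
        · exact le_box_iff.1 (le_inf (le_box_iff.2 inf_le_left) (le_box_iff.2 inf_le_right))
        · exact le_inf (le_box_iff.1 ((nabla_box_le _).trans inf_le_left))
            (le_box_iff.1 ((nabla_box_le _).trans inf_le_right)))
      (by
        change nabla ⊥ ∉ P
        rw [adj_bot nabla_inf_le_iff]
        exact P.bot_notMem)
      (fun x hx y hy => by
        change nabla (x ⊔ y) ∉ P
        rw [adj_sup nabla_inf_le_iff, sup_mem_iff]
        exact not_or.2 ⟨hx, hy⟩)
      (by
        rintro _ ⟨a, ha, rfl⟩ y hy hxy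
        refine hy (P.mem_of_le (nabla_mono hxy) ?_)
        rwa [hs])
    refine ⟨Q, rel_iff.2 fun c hc => by_contra fun h => hI c h hc, fun Z hZ a ha => ?_⟩
    have := rel_iff.1 hZ _ (hF _ ⟨a, ha, rfl⟩)
    rwa [hs] at this
  | Fu =>
    intro P
    have hs : ∀ a : A, box (nabla a) = a := fun a => by
      obtain ⟨b, rfl⟩ := h a
      exact le_antisymm (le_box_iff.1 ((nabla_box_le _).trans (nabla_box_le _)))
        (le_box_nabla _)
    have hle : ∀ a b : A, nabla a ≤ nabla b → a ≤ b := fun a b hab => by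
      have := le_box_iff.1 hab
      rwa [hs] at this
    obtain ⟨Q, hF, hI⟩ := exists_of_disjoint {x | ∃ a ∈ P, nabla a ≤ x}
      {x : A | ∃ b ∉ P, x = nabla b} ⟨⊤, P.top_mem, le_top⟩
      (by
        rintro x ⟨a, ha, hx⟩ y ⟨b, hb, hy⟩
        exact ⟨a ⊓ b, P.inf_mem_iff.2 ⟨ha, hb⟩, le_inf ((nabla_mono inf_le_left).trans hx)
          ((nabla_mono inf_le_right).trans hy)⟩)
      ⟨⊥, P.bot_notMem, (adj_bot nabla_inf_le_iff).symm⟩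
      (by
        rintro _ ⟨a, ha, rfl⟩ _ ⟨b, hb, rfl⟩
        exact ⟨a ⊔ b, fun h => (P.sup_mem_iff.1 h).elim ha hb, (adj_sup nabla_inf_le_iff a b).symm⟩)
      (by
        rintro x ⟨a, ha, hx⟩ _ ⟨b, hb, rfl⟩ hxy
        exact hb (P.mem_of_le (hle a b (hx.trans hxy)) ha))
    refine ⟨Q, rel_iff.2 fun c hc => hF _ ⟨c, hc, le_rfl⟩, fun Z hZ a ha => ?_⟩
    by_contra hn
    exact hI _ ⟨a, hn, rfl⟩ (rel_iff.1 hZ a ha)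

variable {B : Type u} [DistribLattice B] [BoundedOrder B] [NablaAlgebra B]

/-- The inverse image map of a `∇`-algebra morphism on prime filters. -/
def preimageMap (f : NablaHom A B) : NablaSpaceMap (PrimeFilter B) (PrimeFilter A) where
  toFun P := ofSet {a | f a ∈ P} (by simp [f.map_top, P.top_mem]) (by simp [f.map_bot, P.bot_notMem])
    (by simp [f.map_inf, inf_mem_iff]) (by simp [f.map_sup, sup_mem_iff])
  monotone' P Q h a ha := h ha
  continuous_toFun := by
    refine continuous_generateFrom_iff.2 ?_
    rintro _ ⟨a, b, rfl⟩
    exact isOpen_basic (f a) (f b)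
  map_rel' P Q h := rel_iff.2 fun a ha => by
    change f (nabla a) ∈ Q
    rw [f.map_nabla]
    exact rel_iff.1 h _ ha
  exists_rel_right' P L' h := by
    obtain ⟨L, h₁, h₂⟩ := adj_exists_right nabla_inf_le_iff nabla_inf_le_iff
      f.toBoundedLatticeHom f.map_imp P L' (rel_iff.1 h)
    exact ⟨L, rel_iff.2 h₁, SetLike.ext h₂⟩
  exists_rel_left' P L' h := by
    obtain ⟨L, h₁, h₂⟩ := adj_exists_left nabla_inf_le_iff
      f.toBoundedLatticeHom f.map_nabla P L' (rel_iff.1 h)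
    exact ⟨L, rel_iff.2 h₁, h₂⟩

theorem mem_preimageMap {f : NablaHom A B} {P : PrimeFilter B} {a : A} :
    a ∈ preimageMap f P ↔ f a ∈ P := Iff.rfl

end NablaAlgebra

section HeytingAlgebra

variable {A : Type u} [HeytingAlgebra A]

instance : EsakiaSpace (PrimeFilter A) where
  isClopen_downset U hU := by
    have adj : ∀ a b c : A, _root_.id c ⊓ a ≤ b ↔ c ≤ a ⇨ b := fun a b c => le_himp_iff.symm
    exact adj_isClopen adj U hU

variable {B : Type u} [HeytingAlgebra B] [NablaAlgebra A] [NablaAlgebra B]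

/-- The inverse image map of a Heyting `∇`-algebra morphism on prime filters. -/
def heytingPreimageMap (f : HeytingNablaHom A B) :
    HeytingNablaSpaceMap (PrimeFilter B) (PrimeFilter A) where
  toNablaSpaceMap := preimageMap f.toNablaHom
  exists_le' P L' h := by
    have adjA : ∀ a b c : A, _root_.id c ⊓ a ≤ b ↔ c ≤ a ⇨ b := fun a b c => le_himp_iff.symm
    have adjB : ∀ a b c : B, _root_.id c ⊓ a ≤ b ↔ c ≤ a ⇨ b := fun a b c => le_himp_iff.symm
    obtain ⟨L, h₁, h₂⟩ := adj_exists_right adjA adjB f.toBoundedLatticeHom f.map_himp P L' h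
    exact ⟨L, h₁, SetLike.ext h₂⟩

end HeytingAlgebra

end PrimeFilter

/-- `α(a) = {P | a ∈ P}`. -/
def alphaMap {A : Type u} [DistribLattice A] [BoundedOrder A] (a : A) :
    ClopenUpperSet (PrimeFilter A) :=
  ⟨⟨{P | a ∈ P}, PrimeFilter.isClopen_basic a⟩, fun _ _ h₁ h₂ => h₁ h₂⟩

/-- `β(x) = {U | x ∈ U}`. -/
def betaMap {X : Type u} [TopologicalSpace X] [PartialOrder X] (x : X) :
    PrimeFilter (ClopenUpperSet X) :=
  PrimeFilter.ofSet {U | x ∈ U} trivial id (fun _ _ => Iff.rfl) (fun _ _ => Iff.rfl)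

/-- The functor `𝔖 : Alg_∇(D, C) ⥤ Space_∇(C)ᵒᵖ`: prime filters and inverse images. -/
def primeFilterFunctor (C : Set NablaCond) : DNablaAlg.{u} C ⥤ (NablaSp.{u} C)ᵒᵖ where
  obj A := op
    { carrier := PrimeFilter A
      satisfies := fun c hc => PrimeFilter.satisfies c (A.satisfies c hc) }
  map f := Quiver.Hom.op ⟨PrimeFilter.preimageMap f.hom⟩

/-- The functor `𝔖 : Alg_∇^H(D, C) ⥤ Space_∇^H(C)ᵒᵖ`. -/
def heytingPrimeFilterFunctor (C : Set NablaCond) : HNablaAlg.{u} C ⥤ (HNablaSp.{u} C)ᵒᵖ where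
  obj A := op
    { carrier := PrimeFilter A
      satisfies := fun c hc => PrimeFilter.satisfies c (A.satisfies c hc) }
  map f := Quiver.Hom.op ⟨PrimeFilter.heytingPreimageMap f.hom⟩

end NablaDuality

open NablaDuality

/-!
The duality is Priestley duality, with `∇` and `→` carried along by the relation `R`.

For an algebra `A`, the map `α(a) = {P | a ∈ P}` is an order isomorphism onto the clopen upsets
of prime filters: it is an embedding by the prime filter theorem and surjective by compactness
(`alphaOrderIso`). It preserves `∇` because `∇ a ∈ Q` exactly when some prime filter `P ∋ a` has
`∇[P] ⊆ Q` (`PrimeFilter.adj_mem_iff`). An order isomorphism preserving `∇` preserves `→`, which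
is determined by the adjunction, and it preserves the Heyting implication when there is one. So
`α` and its inverse are morphisms (`NablaHom.ofOrderIso`).

For a space `X`, the map `β(x) = {U | x ∈ U}` is a homeomorphism and an order isomorphism by
Priestley separation and compactness (`betaHomeomorph`, `betaMap_le_betaMap_iff`). The one fact
about `R` is `rel_betaMap_iff`: if `(x, y) ∉ R`, then the closed upset `R[x]` is contained in a
clopen upset `V` omitting `y`, and the clopen upset `□ V` contains `x` whereas `∇ □ V ⊆ V`
omits `y`. A homeomorphism preserving and reflecting `≤` and `R` satisfies all back conditions,
so `β` and its inverse are morphisms (`NablaSpaceMap.ofHomeomorph`).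

Naturality and the triangle identity hold by unfolding membership.
-/

namespace NablaDuality

open _root_.NablaDuality.NablaAlgebra (nabla nabla_inf_le_iff)
open _root_.NablaDuality.KripkeFrame (rel rel_of_le)

/-! ### Isomorphisms of algebras -/

section OrderIso

/-- An order isomorphism preserving `∇` is a `∇`-algebra morphism: the adjunction determines `→`
from `∇` and the order. -/
def NablaHom.ofOrderIso {A B : Type u} [Lattice A] [BoundedOrder A] [NablaAlgebra A]
    [Lattice B] [BoundedOrder B] [NablaAlgebra B] (e : A ≃o B)
    (he : ∀ a, e (nabla a) = nabla (e a)) : NablaHom A B where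
  toFun := e
  map_sup' := e.map_sup
  map_inf' := e.map_inf
  map_top' := e.map_top
  map_bot' := e.map_bot
  map_nabla' := he
  map_imp' a b := by
    refine eq_of_forall_le_iff fun c => ?_
    obtain ⟨c, rfl⟩ := e.surjective c
    rw [← nabla_inf_le_iff, ← he, ← OrderIso.map_inf, e.le_iff_le, e.le_iff_le, nabla_inf_le_iff]

/-- An order isomorphism preserving `∇` is a Heyting `∇`-algebra morphism. -/
def HeytingNablaHom.ofOrderIso {A B : Type u} [HeytingAlgebra A] [NablaAlgebra A]
    [HeytingAlgebra B] [NablaAlgebra B] (e : A ≃o B)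
    (he : ∀ a, e (nabla a) = nabla (e a)) : HeytingNablaHom A B where
  toNablaHom := NablaHom.ofOrderIso e he
  map_himp' := HeytingHomClass.map_himp e

theorem nabla_orderIso_symm {A B : Type u} [Lattice A] [BoundedOrder A] [NablaAlgebra A]
    [Lattice B] [BoundedOrder B] [NablaAlgebra B] {e : A ≃o B}
    (he : ∀ a, e (nabla a) = nabla (e a)) (b : B) : e.symm (nabla b) = nabla (e.symm b) := by
  rw [e.symm_apply_eq, he, e.apply_symm_apply]

variable {C : Set NablaCond}

/-- The isomorphism of `Alg_∇(D, C)` given by an order isomorphism preserving `∇`. -/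
def DNablaAlg.isoOfOrderIso {A B : DNablaAlg.{u} C} (e : A ≃o B)
    (he : ∀ a, e (nabla a) = nabla (e a)) : A ≅ B where
  hom := ⟨NablaHom.ofOrderIso e he⟩
  inv := ⟨NablaHom.ofOrderIso e.symm (nabla_orderIso_symm he)⟩
  hom_inv_id := DNablaAlg.Hom.ext (NablaHom.ext e.symm_apply_apply)
  inv_hom_id := DNablaAlg.Hom.ext (NablaHom.ext e.apply_symm_apply)

/-- The isomorphism of `Alg_∇^H(D, C)` given by an order isomorphism preserving `∇`. -/
def HNablaAlg.isoOfOrderIso {A B : HNablaAlg.{u} C} (e : A ≃o B)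
    (he : ∀ a, e (nabla a) = nabla (e a)) : A ≅ B where
  hom := ⟨HeytingNablaHom.ofOrderIso e he⟩
  inv := ⟨HeytingNablaHom.ofOrderIso e.symm (nabla_orderIso_symm he)⟩
  hom_inv_id := HNablaAlg.Hom.ext (HeytingNablaHom.ext e.symm_apply_apply)
  inv_hom_id := HNablaAlg.Hom.ext (HeytingNablaHom.ext e.apply_symm_apply)

end OrderIso

/-! ### Isomorphisms of spaces -/

section Homeomorph

variable {X Y : Type u} [TopologicalSpace X] [PartialOrder X] [NablaSpace X]
  [TopologicalSpace Y] [PartialOrder Y] [NablaSpace Y]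

/-- A homeomorphism preserving and reflecting the order and the relation is a `∇`-space map. -/
def NablaSpaceMap.ofHomeomorph (e : X ≃ₜ Y) (hle : ∀ x y, e x ≤ e y ↔ x ≤ y)
    (hrel : ∀ x y, rel (e x) (e y) ↔ rel x y) : NablaSpaceMap X Y where
  toFun := e
  monotone' x y := (hle x y).2
  continuous_toFun := e.continuous
  map_rel' x y := (hrel x y).2
  exists_rel_right' x y' h := by
    obtain ⟨y, rfl⟩ := e.surjective y'
    exact ⟨y, (hrel x y).1 h, rfl⟩
  exists_rel_left' x y' h := by
    obtain ⟨y, rfl⟩ := e.surjective y'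
    exact ⟨y, (hrel y x).1 h, le_rfl⟩

/-- A homeomorphism preserving and reflecting the order and the relation is a Heyting `∇`-space
map. -/
def HeytingNablaSpaceMap.ofHomeomorph (e : X ≃ₜ Y) (hle : ∀ x y, e x ≤ e y ↔ x ≤ y)
    (hrel : ∀ x y, rel (e x) (e y) ↔ rel x y) : HeytingNablaSpaceMap X Y where
  toNablaSpaceMap := NablaSpaceMap.ofHomeomorph e hle hrel
  exists_le' x y' h := by
    obtain ⟨y, rfl⟩ := e.surjective y'
    exact ⟨y, (hle x y).1 h, rfl⟩

variable {C : Set NablaCond}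

/-- The isomorphism of `Space_∇(C)` given by a homeomorphism preserving and reflecting the order
and the relation. -/
def NablaSp.isoOfHomeomorph {X Y : NablaSp.{u} C} (e : X ≃ₜ Y)
    (hle : ∀ x y, e x ≤ e y ↔ x ≤ y) (hrel : ∀ x y, rel (e x) (e y) ↔ rel x y) : X ≅ Y where
  hom := ⟨NablaSpaceMap.ofHomeomorph e hle hrel⟩
  inv := ⟨NablaSpaceMap.ofHomeomorph e.symm (fun x y => by simp [← hle])
    (fun x y => by simp [← hrel])⟩
  hom_inv_id := NablaSp.Hom.ext (NablaSpaceMap.ext e.symm_apply_apply)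
  inv_hom_id := NablaSp.Hom.ext (NablaSpaceMap.ext e.apply_symm_apply)

/-- The isomorphism of `Space_∇^H(C)` given by a homeomorphism preserving and reflecting the
order and the relation. -/
def HNablaSp.isoOfHomeomorph {X Y : HNablaSp.{u} C} (e : X ≃ₜ Y)
    (hle : ∀ x y, e x ≤ e y ↔ x ≤ y) (hrel : ∀ x y, rel (e x) (e y) ↔ rel x y) : X ≅ Y where
  hom := ⟨HeytingNablaSpaceMap.ofHomeomorph e hle hrel⟩
  inv := ⟨HeytingNablaSpaceMap.ofHomeomorph e.symm (fun x y => by simp [← hle])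
    (fun x y => by simp [← hrel])⟩
  hom_inv_id := HNablaSp.Hom.ext (HeytingNablaSpaceMap.ext e.symm_apply_apply)
  inv_hom_id := HNablaSp.Hom.ext (HeytingNablaSpaceMap.ext e.apply_symm_apply)

end Homeomorph

/-! ### Clopen upsets of prime filters -/

section Alpha

variable {A : Type u} [DistribLattice A] [BoundedOrder A]

theorem alphaMap_le_alphaMap_iff {a b : A} : alphaMap a ≤ alphaMap b ↔ a ≤ b := by
  refine ⟨fun h => ?_, fun h P ha => P.mem_of_le h ha⟩
  by_contra hab
  obtain ⟨P, hF, hI⟩ := PrimeFilter.exists_of_disjoint {x | a ≤ x} {x | x ≤ b} le_top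
    (fun _ h₁ _ h₂ => le_inf h₁ h₂) bot_le (fun _ h₁ _ h₂ => sup_le h₁ h₂)
    (fun x hx y hy hxy => hab (le_trans hx (hxy.trans hy)))
  exact hI b le_rfl (h (hF a le_rfl))

theorem alphaMap_surjective :
    Function.Surjective (alphaMap : A → ClopenUpperSet (PrimeFilter A)) := fun V => by
  obtain ⟨a, ha⟩ :=
    PrimeFilter.exists_eq_of_clopenUpper (V : Set (PrimeFilter A)) V.isClopen V.upper
  exact ⟨a, SetLike.coe_injective ha.symm⟩

/-- `α` as an order isomorphism. -/
noncomputable def alphaOrderIso (A : Type u) [DistribLattice A] [BoundedOrder A] :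
    A ≃o ClopenUpperSet (PrimeFilter A) :=
  RelIso.ofSurjective (OrderEmbedding.ofMapLEIff alphaMap fun _ _ => alphaMap_le_alphaMap_iff)
    alphaMap_surjective

theorem alphaMap_nabla [NablaAlgebra A] (a : A) : alphaMap (nabla a) = nabla (alphaMap a) := by
  refine SetLike.ext fun Q => (PrimeFilter.adj_mem_iff nabla_inf_le_iff a Q).trans ?_
  rw [mem_nabla_iff]
  exact exists_congr fun P => and_congr_right fun _ => PrimeFilter.rel_iff.symm

end Alpha

/-! ### Prime filters of clopen upsets -/

section Beta

variable {X : Type u} [TopologicalSpace X] [PartialOrder X]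

theorem betaMap_le_betaMap_iff [PriestleySpace X] {x y : X} :
    betaMap x ≤ betaMap y ↔ x ≤ y := by
  refine ⟨fun h => ?_, fun h U hU => U.upper h hU⟩
  by_contra hxy
  obtain ⟨U, hU, hU', hx, hy⟩ := PriestleySpace.priestley hxy
  exact hy (@h (⟨⟨U, hU⟩, hU'⟩ : ClopenUpperSet X) hx)

theorem continuous_betaMap : Continuous (betaMap : X → PrimeFilter (ClopenUpperSet X)) := by
  refine continuous_generateFrom_iff.2 ?_
  rintro _ ⟨U, V, rfl⟩
  exact (U.isClopen.diff V.isClopen).isOpen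

theorem betaMap_surjective [CompactSpace X] :
    Function.Surjective (betaMap : X → PrimeFilter (ClopenUpperSet X)) := fun P => by
  have : Nonempty {p : ClopenUpperSet X × ClopenUpperSet X // p.1 ∈ P ∧ p.2 ∉ P} :=
    ⟨⟨(⊤, ⊥), P.top_mem, P.bot_notMem⟩⟩
  -- The sets `U \ V` with `U ∈ P` and `V ∉ P` are closed, nonempty and directed.
  obtain ⟨x, hx⟩ := IsCompact.nonempty_iInter_of_directed_nonempty_isCompact_isClosed
    (fun p : {p : ClopenUpperSet X × ClopenUpperSet X // p.1 ∈ P ∧ p.2 ∉ P} =>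
      (p.1.1 : Set X) \ p.1.2)
    (fun p q => ⟨⟨(p.1.1 ⊓ q.1.1, p.1.2 ⊔ q.1.2), P.inf_mem_iff.2 ⟨p.2.1, q.2.1⟩,
        fun h => (P.sup_mem_iff.1 h).elim p.2.2 q.2.2⟩,
      fun z hz => ⟨hz.1.1, fun h => hz.2 (Or.inl h)⟩,
      fun z hz => ⟨hz.1.2, fun h => hz.2 (Or.inr h)⟩⟩)
    (fun p => Set.nonempty_of_not_subset fun h => p.2.2 (P.mem_of_le h p.2.1))
    (fun p => (p.1.1.isClopen.diff p.1.2.isClopen).isClosed.isCompact)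
    (fun p => (p.1.1.isClopen.diff p.1.2.isClopen).isClosed)
  rw [Set.mem_iInter] at hx
  refine ⟨x, SetLike.ext fun U => ⟨fun hU => ?_, fun hU => ?_⟩⟩
  · by_contra hn
    exact (hx ⟨(⊤, U), P.top_mem, hn⟩).2 hU
  · exact (hx ⟨(U, ⊥), hU, P.bot_notMem⟩).1

/-- `β` as a homeomorphism: it is a continuous bijection from a compact to a Hausdorff space. -/
noncomputable def betaHomeomorph (X : Type u) [TopologicalSpace X] [PartialOrder X]
    [CompactSpace X] [PriestleySpace X] : X ≃ₜ PrimeFilter (ClopenUpperSet X) :=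
  Continuous.homeoOfEquivCompactToT2 (f := Equiv.ofBijective betaMap
    ⟨fun _ _ h => le_antisymm (betaMap_le_betaMap_iff.1 h.le) (betaMap_le_betaMap_iff.1 h.ge),
      betaMap_surjective⟩) continuous_betaMap

/-- In a Priestley space, a closed upset is separated from a point outside it by a clopen
upset. -/
theorem exists_clopenUpperSet_of_notMem [CompactSpace X] [PriestleySpace X] {F : Set X}
    (hF : IsClosed F) (hF' : IsUpperSet F) {y : X} (hy : y ∉ F) :
    ∃ V : ClopenUpperSet X, F ⊆ V ∧ y ∉ V := by
  have : Nonempty {V : ClopenUpperSet X // y ∉ V} := ⟨⟨⊥, id⟩⟩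
  obtain ⟨V, hV⟩ := hF.isCompact.elim_directed_cover
    (fun V : {V : ClopenUpperSet X // y ∉ V} => (V.1 : Set X))
    (fun V => V.1.isClopen.isOpen)
    (fun z hz => by
      obtain ⟨U, hU, hU', hzU, hyU⟩ :=
        PriestleySpace.priestley (fun h : z ≤ y => hy (hF' h hz))
      exact Set.mem_iUnion.2 ⟨⟨⟨⟨U, hU⟩, hU'⟩, hyU⟩, hzU⟩)
    (fun V W => ⟨⟨V.1 ⊔ W.1, fun h => h.elim V.2 W.2⟩,
      fun _ h => Or.inl h, fun _ h => Or.inr h⟩)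
  exact ⟨V.1, hV, V.2⟩

theorem rel_betaMap_iff [NablaSpace X] {x y : X} : rel (betaMap x) (betaMap y) ↔ rel x y := by
  rw [PrimeFilter.rel_iff]
  refine ⟨fun h => ?_, fun h U hU => ⟨x, hU, h⟩⟩
  by_contra hxy
  obtain ⟨V, hV, hy⟩ := exists_clopenUpperSet_of_notMem (NablaSpace.isClosed_rel x)
    (fun _ _ hle hr => rel_of_le le_rfl hr hle) hxy
  exact hy (PrimeFilter.nabla_box_le V (h (box V) (mem_imp_iff.2 fun z hz _ => hV hz)))

end Beta

/-! ### The unit and the counit -/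

section Equivalence

variable (C : Set NablaCond)

/-- The natural isomorphism `α : 𝟭 ≅ 𝔄𝔖`. -/
noncomputable def alphaIso :
    𝟭 (DNablaAlg.{u} C) ≅ primeFilterFunctor C ⋙ clopenUpsetFunctor C :=
  NatIso.ofComponents
    (fun A => DNablaAlg.isoOfOrderIso
      (B := (clopenUpsetFunctor C).obj ((primeFilterFunctor C).obj A))
      (alphaOrderIso A) alphaMap_nabla)
    (fun _ => rfl)

/-- The natural isomorphism `β : 𝔖𝔄 ≅ 𝟭`, with components in the opposite category. -/
noncomputable def betaIso :
    clopenUpsetFunctor C ⋙ primeFilterFunctor C ≅ 𝟭 (NablaSp.{u} C)ᵒᵖ :=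
  NatIso.ofComponents
    (fun X => (NablaSp.isoOfHomeomorph
      (Y := ((primeFilterFunctor C).obj ((clopenUpsetFunctor C).obj X)).unop)
      (betaHomeomorph X.unop) (fun _ _ => betaMap_le_betaMap_iff) (fun _ _ => rel_betaMap_iff)).op)
    (fun _ => rfl)

/-- The natural isomorphism `α : 𝟭 ≅ 𝔄𝔖` in the explicitly Heyting case. -/
noncomputable def heytingAlphaIso :
    𝟭 (HNablaAlg.{u} C) ≅ heytingPrimeFilterFunctor C ⋙ heytingClopenUpsetFunctor C :=
  NatIso.ofComponents
    (fun A => HNablaAlg.isoOfOrderIso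
      (B := (heytingClopenUpsetFunctor C).obj ((heytingPrimeFilterFunctor C).obj A))
      (alphaOrderIso A) alphaMap_nabla)
    (fun _ => rfl)

/-- The natural isomorphism `β : 𝔖𝔄 ≅ 𝟭` in the explicitly Heyting case. -/
noncomputable def heytingBetaIso :
    heytingClopenUpsetFunctor C ⋙ heytingPrimeFilterFunctor C ≅ 𝟭 (HNablaSp.{u} C)ᵒᵖ :=
  NatIso.ofComponents
    (fun X => (HNablaSp.isoOfHomeomorph
      (Y := ((heytingPrimeFilterFunctor C).obj ((heytingClopenUpsetFunctor C).obj X)).unop)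
      (betaHomeomorph X.unop) (fun _ _ => betaMap_le_betaMap_iff) (fun _ _ => rel_betaMap_iff)).op)
    (fun _ => rfl)

end Equivalence

end NablaDuality

theorem mainTheorem1 (C : Set NablaCond) :
    (∃ (e : DNablaAlg.{u} C ≌ (NablaSp.{u} C)ᵒᵖ)
      (α : 𝟭 (DNablaAlg.{u} C) ≅ primeFilterFunctor C ⋙ clopenUpsetFunctor C)
      (β : clopenUpsetFunctor C ⋙ primeFilterFunctor C ≅ 𝟭 (NablaSp.{u} C)ᵒᵖ)
      (triangle : ∀ A : DNablaAlg.{u} C,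
        (primeFilterFunctor C).map (α.hom.app A) ≫ β.hom.app ((primeFilterFunctor C).obj A) =
          𝟙 ((primeFilterFunctor C).obj A)),
      e = { functor := primeFilterFunctor C
            inverse := clopenUpsetFunctor C
            unitIso := α
            counitIso := β
            functor_unitIso_comp := triangle } ∧
      (∀ (A : DNablaAlg.{u} C) (a : A), (α.hom.app A).hom a = alphaMap a) ∧
      (∀ (X : NablaSp.{u} C) (x : X), (β.hom.app (op X)).unop.hom x = betaMap x)) ∧
    (∃ (e : HNablaAlg.{u} C ≌ (HNablaSp.{u} C)ᵒᵖ)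
      (α : 𝟭 (HNablaAlg.{u} C) ≅ heytingPrimeFilterFunctor C ⋙ heytingClopenUpsetFunctor C)
      (β : heytingClopenUpsetFunctor C ⋙ heytingPrimeFilterFunctor C ≅ 𝟭 (HNablaSp.{u} C)ᵒᵖ)
      (triangle : ∀ A : HNablaAlg.{u} C,
        (heytingPrimeFilterFunctor C).map (α.hom.app A) ≫
            β.hom.app ((heytingPrimeFilterFunctor C).obj A) =
          𝟙 ((heytingPrimeFilterFunctor C).obj A)),
      e = { functor := heytingPrimeFilterFunctor C
            inverse := heytingClopenUpsetFunctor C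
            unitIso := α
            counitIso := β
            functor_unitIso_comp := triangle } ∧
      (∀ (A : HNablaAlg.{u} C) (a : A), (α.hom.app A).hom a = alphaMap a) ∧
      (∀ (X : HNablaSp.{u} C) (x : X), (β.hom.app (op X)).unop.hom x = betaMap x)) := by
  -- The triangle identity says that `P` and `{a | α(a) ∈ β(P)}` have the same members.
  exact ⟨⟨_, alphaIso C, betaIso C, fun _ => rfl, rfl, fun _ _ => rfl, fun _ _ => rfl⟩,
    ⟨_, heytingAlphaIso C, heytingBetaIso C, fun _ => rfl, rfl, fun _ _ => rfl, fun _ _ => rfl⟩⟩
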